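/- All graphs are finite, simple and undirected, the order of a path is its number of vertices, and logarithms are in base $2$. For a class $\mathcal{C}$ of graphs (closed under isomorphism) and $n\in\mathbb{N}$, let $f_{\mathcal{C}}(n)$ be the largest integer $k$ such that every graph $G\in\mathcal{C}$ that contains a path of order $n$ (as a not necessarily induced subgraph) contains an induced path of order at least $k$; if no graph of $\mathcal{C}$ contains a path of order $n$, put $f_{\mathcal{C}}(n)=\infty$. The class $\mathcal{C}$ is hereditary if it is closed under taking induced subgraphs. There exists an absolute constant $c>0$ such that for every hereditary class $\mathcal{C}$ of graphs, at least one of the following holds: 1. $f_{\mathcal{C}}(n)=\Omega((\log\log n)^c)$, that is, there is a real $a>0$ (which may depend on $\mathcal{C}$) such that $f_{\mathcal{C}}(n)\ge a(\log\log n)^c$ for all sufficiently large $n$; 2. $f_{\mathcal{C}}(n)=O(1)$, that is, there is an integer $K$ (which may depend on $\mathcal{C}$) such that $f_{\mathcal{C}}(n)\le K$ for all $n$. -/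

import Mathlib

open Filter

/-- A class of graphs: a property of finite simple graphs.  (Every finite graph is isomorphic to
one on a vertex type in `Type`; invariance under isomorphism is part of `GraphClass.IsHereditary`
below.) -/
def GraphClass : Type 1 :=
  ∀ (V : Type) [Finite V], SimpleGraph V → Prop

/-- `G` has a path with exactly `n` vertices, as a not necessarily induced subgraph. -/
def HasPathOfOrder {V : Type} (G : SimpleGraph V) (n : ℕ) : Prop :=
  (SimpleGraph.pathGraph n).IsContained G

/-- `G` has an induced path with exactly `n` vertices. -/
def HasInducedPathOfOrder {V : Type} (G : SimpleGraph V) (n : ℕ) : Prop :=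
  (SimpleGraph.pathGraph n).IsIndContained G

namespace GraphClass

/-- `C` is closed under taking induced subgraphs (up to isomorphism): if `H` is isomorphic to an
induced subgraph of a member of `C`, then `H` is a member of `C`. -/
def IsHereditary (C : GraphClass) : Prop :=
  ∀ (V W : Type) [Finite V] [Finite W] (G : SimpleGraph V) (H : SimpleGraph W),
    C V G → H.IsIndContained G → C W H

/-- Every graph of `C` with a path of order `n` has an induced path of order at least `k`. -/
def ForcesInducedPath (C : GraphClass) (n k : ℕ) : Prop :=
  ∀ (V : Type) [Finite V] (G : SimpleGraph V), C V G → HasPathOfOrder G n →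
    ∃ m : ℕ, k ≤ m ∧ HasInducedPathOfOrder G m

/-- The function `f_C`: the largest `k` such that every graph of `C` with a path of order `n` has
an induced path of order at least `k`.  If some graph of `C` has a path of order `n`, this is a
maximum and a natural number; otherwise every `k` qualifies and the value is `⊤`. -/
noncomputable def inducedPathFn (C : GraphClass) (n : ℕ) : ℕ∞ :=
  ⨆ (k : ℕ) (_ : C.ForcesInducedPath n k), (k : ℕ∞)

end GraphClass

/-- `f = Ω(g)` for a function `f` with values in `ℕ ∪ {∞}`: there is a constant `a > 0` with
`f n ≥ a * g n` for all large `n`. -/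
def IsBigOmega (f : ℕ → ℕ∞) (g : ℕ → ℝ) : Prop :=
  ∃ a : ℝ, 0 < a ∧ ∀ᶠ n : ℕ in atTop, ENNReal.ofReal (a * g n) ≤ (f n : ENNReal)

/-- `f = O(1)` for a function `f` with values in `ℕ ∪ {∞}`: `f` is bounded by a (finite)
constant. -/
def IsBigOOne (f : ℕ → ℕ∞) : Prop :=
  ∃ K : ℕ, ∀ n : ℕ, f n ≤ (K : ℕ∞)

/-! The dichotomy is whether, for some t, no graph of the class contains K_{t,t} as a not
necessarily induced subgraph.

If every t fails, Ramsey's theorem applied to both sides of large bicliques puts all cliques or all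
induced K_{n,n} into the class (`isBigOOne_of_forall_biclique`). These have arbitrarily long paths,
but no induced path of order above 3.

If some t works, suppose that a graph has a very long path p but no induced path of order k or more.
Disjoint connected blocks of at most k vertices are grown along p (`IsBlockSequence.exists_succ`).
Few vertices have t neighbours in the blocks built so far, so some long interval of p avoids them
all; a shortest connection to that interval is the next block. It touches at most k(t+1) earlier
blocks, because the interval it runs through was chosen sparse one step before. Breadth-first search
on the block indices, whose back-degree is now bounded, yields a long chain in which only
consecutive blocks touch (`exists_descending_chain`), and a geodesic through its union is a
forbidden induced path.

The number of blocks and the factor by which the interval shrinks at each step can both be taken as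
2^{O(k²)}, so a path of order 2^{2^{O(k²)}} suffices. This gives the exponent c = 1/2. -/

namespace SimpleGraph

/-! ### Induced paths from geodesics and from chains of connected sets -/

variable {V : Type*} {G : SimpleGraph V}

theorem Walk.dist_getVert_of_length_eq_dist {u v : V} (p : G.Walk u v)
    (hp : p.length = G.dist u v) {i : ℕ} (hi : i ≤ p.length) : G.dist u (p.getVert i) = i := by
  have h1 : G.dist u (p.getVert i) ≤ i := by
    have := dist_le (p.take i)
    rw [Walk.take_length] at this
    omega
  have h2 : G.dist (p.getVert i) v ≤ p.length - i := by
    have := dist_le (p.drop i)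
    rwa [Walk.drop_length] at this
  have h3 := (p.take i).reachable.dist_triangle_left v
  omega

/-- A shortest walk is an induced path. -/
theorem Walk.pathGraph_isIndContained_of_length_eq_dist {u v : V} (p : G.Walk u v)
    (hp : p.length = G.dist u v) : (pathGraph (p.length + 1)).IsIndContained G := by
  have hd : ∀ i : Fin (p.length + 1), G.dist u (p.getVert i) = i := fun i =>
    p.dist_getVert_of_length_eq_dist hp (by omega)
  have hinj : Function.Injective fun i : Fin (p.length + 1) => p.getVert i := by
    intro i j hij
    have h := congrArg (G.dist u) hij
    simp only [hd] at h
    exact Fin.ext h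
  refine ⟨⟨⟨_, hinj⟩, ?_⟩⟩
  intro i j
  simp only [Function.Embedding.coeFn_mk, pathGraph_adj]
  constructor
  · intro h
    have h1 := h.diff_dist_adj (u := u)
    rw [hd, hd] at h1
    have h2 : (i : ℕ) ≠ j := by
      intro h3
      rw [h3] at h
      exact G.loopless.irrefl _ h
    omega
  · rintro (h | h)
    · rw [← h]; exact p.adj_getVert_succ (by omega)
    · rw [← h]; exact (p.adj_getVert_succ (by omega)).symm

/-- Inside a connected set `U` of a graph without long induced paths, a vertex outside of `J ⊆ U`
can be joined to `J` by a small connected set. -/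
theorem exists_small_connector {U J : Set V} {a : V} {k : ℕ}
    (hk : ∀ m, k ≤ m → ¬ (pathGraph m).IsIndContained G)
    (hU : (G.induce U).Preconnected) (ha : a ∈ U) (hJU : J ⊆ U) (hJ : J.Nonempty) (haJ : a ∉ J) :
    ∃ R : Finset V, (R : Set V) ⊆ U \ J ∧ a ∈ R ∧ R.card ≤ k ∧
      (G.induce (R : Set V)).Preconnected ∧ ∃ x ∈ R, ∃ y ∈ J, G.Adj x y := by
  classical
  have hex : ∃ n, ∃ y : U, (y : V) ∈ J ∧ ∃ p : (G.induce U).Walk y ⟨a, ha⟩, p.length = n := by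
    obtain ⟨y, hy⟩ := hJ
    obtain ⟨p⟩ := hU ⟨y, hJU hy⟩ ⟨a, ha⟩
    exact ⟨_, _, hy, p, rfl⟩
  obtain ⟨y, hy, p, hp⟩ := Nat.find_spec hex
  have hmin : ∀ y' : U, (y' : V) ∈ J → ∀ q : (G.induce U).Walk y' ⟨a, ha⟩,
      p.length ≤ q.length := by
    intro y' hy' q
    rw [hp]
    exact Nat.find_min' hex ⟨y', hy', q, rfl⟩
  -- Minimality over all starting points in `J` makes `p` a geodesic of `G.induce U`, hence an
  -- induced path of order below `k`.
  have hdist : p.length = (G.induce U).dist y ⟨a, ha⟩ := by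
    obtain ⟨q, hq⟩ := p.reachable.exists_walk_length_eq_dist
    exact le_antisymm (hq ▸ hmin y hy q) (dist_le p)
  have hlen : p.length + 1 < k := by
    by_contra! h
    exact hk _ h ((p.pathGraph_isIndContained_of_length_eq_dist hdist).trans
      ⟨Embedding.induce U⟩)
  clear hp hdist
  cases p with
  | nil => exact absurd hy haJ
  | @cons _ x _ h q =>
    -- `R` is the walk without its first vertex, the one in `J`. A later visit to `J` would give a
    -- shorter walk.
    refine ⟨(q.map (Embedding.induce U).toHom).support.toFinset, ?_, ?_, ?_, ?_, ?_⟩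
    · intro z hz
      simp only [List.coe_toFinset, Set.mem_ofPred_eq, Walk.support_map, List.mem_map] at hz
      obtain ⟨w, hw, rfl⟩ := hz
      refine ⟨w.2, fun hwJ => ?_⟩
      have h1 := hmin w hwJ (q.dropUntil w hw)
      have h2 := q.length_dropUntil_le_length hw
      rw [Walk.length_cons] at h1
      omega
    · rw [List.mem_toFinset]
      exact Walk.end_mem_support _
    · refine (List.toFinset_card_le _).trans ?_
      rw [Walk.length_support, Walk.length_map]
      rw [Walk.length_cons] at hlen
      omega
    · rw [List.coe_toFinset]
      exact (Walk.connected_induce_support _).preconnected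
    · refine ⟨x, ?_, y, hy, ?_⟩
      · rw [List.mem_toFinset]
        exact Walk.start_mem_support _
      · exact h.symm

/-- A connected set on which a `1`-Lipschitz function attains the values `0` and `s` contains an
induced path with more than `s` vertices. -/
theorem exists_induced_path_of_lipschitz {U : Set V} (hU : (G.induce U).Preconnected) (f : V → ℕ)
    (hf : ∀ x ∈ U, ∀ y ∈ U, G.Adj x y → f x ≤ f y + 1) {u v : V} (hu : u ∈ U) (hv : v ∈ U)
    (hfv : f v = 0) : ∃ m, f u < m ∧ (pathGraph m).IsIndContained G := by
  obtain ⟨p, hp⟩ := (hU ⟨u, hu⟩ ⟨v, hv⟩).exists_walk_length_eq_dist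
  refine ⟨p.length + 1, ?_, (p.pathGraph_isIndContained_of_length_eq_dist hp).trans
    ⟨Embedding.induce U⟩⟩
  have key : ∀ (x y : U) (q : (G.induce U).Walk x y), f x ≤ f y + q.length := by
    intro x y q
    induction q with
    | nil => simp
    | @cons x y z h q ih =>
      have := hf x x.2 y y.2 h
      rw [Walk.length_cons]
      omega
  have := key _ _ p
  simp only [hfv] at this
  omega

/-- A sequence of disjoint connected sets such that exactly the consecutive ones are joined by an
edge yields an induced path. -/
theorem exists_induced_path_of_chain (C : ℕ → Set V) (s : ℕ)
    (hconn : ∀ a ≤ s, (G.induce (C a)).Preconnected) (hne : ∀ a ≤ s, (C a).Nonempty)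
    (hdisj : ∀ a ≤ s, ∀ b ≤ s, ∀ x ∈ C a, x ∈ C b → a = b)
    (hadj : ∀ a < s, ∃ x ∈ C a, ∃ y ∈ C (a + 1), G.Adj x y)
    (hnadj : ∀ a ≤ s, ∀ b ≤ s, ∀ x ∈ C a, ∀ y ∈ C b, G.Adj x y → a ≤ b + 1) :
    ∃ m, s < m ∧ (pathGraph m).IsIndContained G := by
  classical
  have hU : ∀ r ≤ s, (G.induce {x | ∃ a ≤ r, x ∈ C a}).Preconnected := by
    intro r
    induction r with
    | zero =>
      intro _
      have : {x | ∃ a ≤ 0, x ∈ C a} = C 0 := by ext x; simp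
      rw [this]
      exact hconn 0 (by omega)
    | succ r ih =>
      intro hr
      have : {x | ∃ a ≤ r + 1, x ∈ C a} = {x | ∃ a ≤ r, x ∈ C a} ∪ C (r + 1) := by
        ext x
        simp only [Set.mem_ofPred_eq, Set.mem_union, Nat.le_succ_iff, or_and_right, exists_or,
          exists_eq_left]
      rw [this]
      obtain ⟨x, hx, y, hy, hxy⟩ := hadj r (by omega)
      exact (connected_induce_union (v := x) (w := y)
        (ih (by omega)) (hconn (r + 1) hr) ⟨r, le_rfl, hx⟩ hy hxy).preconnected
  -- The default value 0 is harmless: the Lipschitz condition is only needed on the union of the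
  -- sets.
  let f : V → ℕ := fun x => if h : ∃ a ≤ s, x ∈ C a then h.choose else 0
  have hf : ∀ a ≤ s, ∀ x ∈ C a, f x = a := by
    intro a ha x hx
    have h : ∃ a ≤ s, x ∈ C a := ⟨a, ha, hx⟩
    simp only [f, dif_pos h]
    exact hdisj _ h.choose_spec.1 _ ha x h.choose_spec.2 hx
  obtain ⟨u, hu⟩ := hne s le_rfl
  obtain ⟨v, hv⟩ := hne 0 (by omega)
  have := exists_induced_path_of_lipschitz (hU s le_rfl) f ?_ ⟨s, le_rfl, hu⟩ ⟨0, by omega, hv⟩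
    (hf 0 (by omega) v hv)
  · rwa [hf s le_rfl u hu] at this
  · rintro x ⟨a, ha, hx⟩ y ⟨b, hb, hy⟩ hxy
    rw [hf a ha x hx, hf b hb y hy]
    exact hnadj a ha b hb x hx y hy hxy

/-! ### Breadth-first search along descending edges -/

/-- The indices at most `r` steps away from `L` along descending steps of `E`. -/
def descendants (E : ℕ → ℕ → Prop) [∀ j, DecidablePred (E j)] (L : ℕ) : ℕ → Finset ℕ
  | 0 => {L}
  | r + 1 => descendants E L r ∪
      (descendants E L r).biUnion fun j => (Finset.range j).filter (E j)

/-- In each round an index contributes itself and at most `D` new ones, so the count grows by a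
factor of at most `D + 1`. -/
theorem card_descendants_le (E : ℕ → ℕ → Prop) [∀ j, DecidablePred (E j)] (L D : ℕ)
    (hD : ∀ j ≤ L, ((Finset.range j).filter (E j)).card ≤ D) (r : ℕ) :
    (∀ j ∈ descendants E L r, j ≤ L) ∧ (descendants E L r).card ≤ (D + 1) ^ r := by
  induction r with
  | zero => simp [descendants]
  | succ r ih =>
    constructor
    · intro j hj
      simp only [descendants, Finset.mem_union, Finset.mem_biUnion, Finset.mem_filter,
        Finset.mem_range] at hj
      rcases hj with hj | ⟨i, hi, hj, -⟩
      · exact ih.1 j hj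
      · have := ih.1 i hi
        omega
    · refine (Finset.card_union_le _ _).trans ?_
      have := Finset.card_biUnion_le_card_mul (descendants E L r)
        (fun j => (Finset.range j).filter (E j)) D fun j hj => hD j (ih.1 j hj)
      calc _ ≤ (descendants E L r).card + (descendants E L r).card * D := by omega
        _ = (descendants E L r).card * (D + 1) := by ring
        _ ≤ (D + 1) ^ r * (D + 1) := Nat.mul_le_mul_right _ ih.2
        _ = _ := by ring

/-- In a graph on `{0, …, L}` containing all edges `{j, j + 1}` in which every vertex has at most
`D` smaller neighbours, there is a long descending path from `L` that is induced. -/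
theorem exists_descending_chain (E : ℕ → ℕ → Prop) (L D s : ℕ)
    (hD : ∀ j ≤ L, {i | i < j ∧ E j i}.ncard ≤ D) (hE : ∀ i < L, E (i + 1) i)
    (hL : (D + 1) ^ s ≤ L) :
    ∃ c : ℕ → ℕ, (∀ a ≤ s, c a ≤ L) ∧ (∀ a < s, c (a + 1) < c a ∧ E (c a) (c (a + 1))) ∧
      ∀ a ≤ s, ∀ b ≤ s, c b < c a → E (c a) (c b) → b ≤ a + 1 := by
  classical
  have hD' : ∀ j ≤ L, ((Finset.range j).filter (E j)).card ≤ D := by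
    intro j hj
    rw [← Set.ncard_coe_finset]
    simpa using hD j hj
  have hmono : Monotone (descendants E L) :=
    monotone_nat_of_le_succ fun r => Finset.subset_union_left
  have hreach : ∀ i ≤ L, ∃ r, L - i ∈ descendants E L r := by
    intro i
    induction i with
    | zero => exact fun _ => ⟨0, by simp [descendants]⟩
    | succ i ih =>
      intro hi
      obtain ⟨r, hr⟩ := ih (by omega)
      refine ⟨r + 1, Finset.mem_union_right _ (Finset.mem_biUnion.2 ⟨_, hr, ?_⟩)⟩
      rw [Finset.mem_filter, Finset.mem_range]
      have := hE (L - (i + 1)) (by omega)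
      rw [show L - (i + 1) + 1 = L - i by omega] at this
      exact ⟨by omega, this⟩
  have hreach' : ∀ i ≤ L, ∃ r, i ∈ descendants E L r := by
    intro i hi
    have := hreach (L - i) (by omega)
    rwa [show L - (L - i) = i by omega] at this
  -- `IsLevel i r` says that `i` is at distance exactly `r` from `L` in the digraph of descending
  -- edges.
  let IsLevel : ℕ → ℕ → Prop := fun i r =>
    i ∈ descendants E L r ∧ ∀ r' < r, i ∉ descendants E L r'
  have hle : ∀ i r, IsLevel i r → i ≤ L := fun i r h => (card_descendants_le E L D hD' r).1 i h.1
  have hstep : ∀ r i, IsLevel i (r + 1) → ∃ j, i < j ∧ E j i ∧ IsLevel j r := by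
    rintro r i ⟨h1, h2⟩
    have h3 := h2 r (by omega)
    simp only [descendants, Finset.mem_union, h3, false_or, Finset.mem_biUnion,
      Finset.mem_filter, Finset.mem_range] at h1
    obtain ⟨j, hj, hij, hE⟩ := h1
    refine ⟨j, hij, hE, hj, fun r' hr' hj' => h2 (r' + 1) (by omega) ?_⟩
    exact Finset.mem_union_right _ (Finset.mem_biUnion.2 ⟨_, hj', by simp [hij, hE]⟩)
  have hchain : ∀ r i, IsLevel i r → ∃ c : ℕ → ℕ, c r = i ∧ (∀ a ≤ r, IsLevel (c a) a) ∧
      ∀ a < r, c (a + 1) < c a ∧ E (c a) (c (a + 1)) := by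
    intro r
    induction r with
    | zero =>
      intro i hi
      exact ⟨fun _ => i, rfl, fun a ha => by obtain rfl : a = 0 := by omega
                                             exact hi, by omega⟩
    | succ r ih =>
      intro i hi
      obtain ⟨j, hij, hE, hj⟩ := hstep r i hi
      obtain ⟨c, hc, hlev, hstep⟩ := ih j hj
      refine ⟨fun a => if a ≤ r then c a else i, by simp, fun a ha => ?_, fun a ha => ?_⟩
      · by_cases h : a ≤ r
        · simpa [h] using hlev a h
        · obtain rfl : a = r + 1 := by omega
          simpa using hi
      · by_cases h : a < r
        · simpa [show a ≤ r by omega, show a + 1 ≤ r by omega] using hstep a h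
        · obtain rfl : a = r := by omega
          simpa [hc] using ⟨hij, hE⟩
  -- The ball of radius `s` holds at most (D+1)^s ≤ L of the L+1 indices, so it misses one.
  obtain ⟨i, hiL, hi⟩ : ∃ i ≤ L, i ∉ descendants E L s := by
    by_contra! h
    have h1 : Finset.range (L + 1) ⊆ descendants E L s := fun i hi =>
      h i (by rw [Finset.mem_range] at hi; omega)
    have h2 := Finset.card_le_card h1
    rw [Finset.card_range] at h2
    have := (card_descendants_le E L D hD' s).2
    omega
  have hlev : IsLevel i (Nat.find (hreach' i hiL)) :=
    ⟨Nat.find_spec (hreach' i hiL), fun r' hr' => Nat.find_min (hreach' i hiL) hr'⟩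
  have hs : s ≤ Nat.find (hreach' i hiL) := by
    by_contra! h
    exact hi (hmono h.le hlev.1)
  obtain ⟨c, -, hc, hc'⟩ := hchain _ i hlev
  refine ⟨c, fun a ha => hle _ a (hc a (by omega)), fun a ha => hc' a (by omega), ?_⟩
  intro a ha b hb hlt hab
  by_contra! h
  -- An edge that skips a level would place `c b` within distance `a + 1 < b`.
  refine (hc b (by omega)).2 (a + 1) h ?_
  exact Finset.mem_union_right _ (Finset.mem_biUnion.2 ⟨_, (hc a (by omega)).1, by
    simp [hlt, hab]⟩)

/-- A sequence of disjoint connected sets in which consecutive ones are joined by an edge and every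
one is joined to few of the previous ones yields a long induced path. -/
theorem exists_induced_path_of_blocks (B : ℕ → Set V) (L D s : ℕ)
    (hconn : ∀ j ≤ L, (G.induce (B j)).Preconnected) (hne : ∀ j ≤ L, (B j).Nonempty)
    (hdisj : ∀ i j, i < j → j ≤ L → ∀ x ∈ B j, x ∉ B i)
    (hadj : ∀ j < L, ∃ x ∈ B j, ∃ y ∈ B (j + 1), G.Adj x y)
    (hD : ∀ j ≤ L, {i | i < j ∧ ∃ x ∈ B j, ∃ y ∈ B i, G.Adj x y}.ncard ≤ D)
    (hL : (D + 1) ^ s ≤ L) :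
    ∃ m, s < m ∧ (pathGraph m).IsIndContained G := by
  obtain ⟨c, hcL, hc, hc'⟩ := exists_descending_chain
    (fun j i => ∃ x ∈ B j, ∃ y ∈ B i, G.Adj x y) L D s hD
    (fun i hi => by
      obtain ⟨x, hx, y, hy, hxy⟩ := hadj i hi
      exact ⟨y, hy, x, hx, hxy.symm⟩) hL
  have hanti : ∀ b ≤ s, ∀ a < b, c b < c a := by
    intro b
    induction b with
    | zero => intro _ a ha; omega
    | succ b ih =>
      intro hb a ha
      have h1 := (hc b (by omega)).1
      rcases Nat.lt_succ_iff_lt_or_eq.1 ha with h | rfl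
      · exact h1.trans (ih (by omega) a h)
      · exact h1
  refine exists_induced_path_of_chain (fun a => B (c a)) s (fun a ha => hconn _ (hcL a ha))
    (fun a ha => hne _ (hcL a ha)) ?_ (fun a ha => (hc a ha).2) ?_
  · intro a ha b hb x hx hx'
    rcases lt_trichotomy a b with h | h | h
    · exact absurd hx' (hdisj _ _ (hanti b hb a h) (hcL a ha) x hx)
    · exact h
    · exact absurd hx (hdisj _ _ (hanti a ha b h) (hcL b hb) x hx')
  · intro a ha b hb x hx y hy hxy
    by_contra! h
    have := hc' b hb a ha (hanti a ha b (by omega)) ⟨y, hy, x, hx, hxy.symm⟩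
    omega

end SimpleGraph

/-! ### Growing blocks along a path in a graph without K_{t,t} -/

namespace SimpleGraph

variable {V : Type*} {G : SimpleGraph V}

/-- In a graph in which every `t` vertices have fewer than `t` common neighbours, few vertices have
`t` or more neighbours in a given finite set. -/
theorem ncard_many_neighbors_le [Finite V] {t : ℕ}
    (hG : ∀ A : Finset V, A.card = t → {v | ∀ a ∈ A, G.Adj v a}.ncard < t) (X : Finset V) :
    {v | t ≤ {x | x ∈ X ∧ G.Adj v x}.ncard}.ncard ≤ X.card ^ t * t := by
  classical
  have := Fintype.ofFinite V
  -- Each such vertex is a common neighbour of some `t`-subset of `X`, and a `t`-subset has fewer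
  -- than `t` of them.
  have hsub : {v | t ≤ {x | x ∈ X ∧ G.Adj v x}.ncard} ⊆
      (((X.powersetCard t).biUnion fun A => Finset.univ.filter fun v => ∀ a ∈ A, G.Adj v a :
        Finset V) : Set V) := by
    intro v hv
    have hv' : t ≤ (X.filter (G.Adj v)).card := by
      rw [← Set.ncard_coe_finset]
      simpa using hv
    obtain ⟨A, hA, hAt⟩ := Finset.exists_subset_card_eq hv'
    simp only [Finset.coe_biUnion, Set.mem_iUnion, Finset.mem_coe, Finset.mem_filter,
      Finset.mem_univ, true_and, Finset.mem_powersetCard]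
    exact ⟨A, ⟨hA.trans (Finset.filter_subset _ _), hAt⟩, fun a ha =>
      (Finset.mem_filter.1 (hA ha)).2⟩
  refine (Set.ncard_le_ncard hsub (Finset.finite_toSet _)).trans ?_
  rw [Set.ncard_coe_finset]
  refine (Finset.card_biUnion_le_card_mul _ _ t ?_).trans ?_
  · intro A hA
    have := hG A (Finset.mem_powersetCard.1 hA).2
    rw [← Set.ncard_coe_finset]
    simpa using this.le
  · rw [Finset.card_powersetCard]
    exact Nat.mul_le_mul_right _ (Nat.choose_le_pow _ _)

/-- Pigeonhole on `s + 1` consecutive intervals of length `q`: each element of `F` spoils at most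
one. -/
theorem exists_subinterval_avoiding (F : Finset ℕ) {s : ℕ} (hF : F.card ≤ s) (a q : ℕ) :
    ∃ b, a ≤ b ∧ b + q ≤ a + (s + 1) * q ∧ ∀ m, b ≤ m → m < b + q → m ∉ F := by
  obtain ⟨j, hj, hjF⟩ : ∃ j ∈ Finset.range (s + 1), j ∉ F.image fun m => (m - a) / q := by
    by_contra! h
    have := (Finset.card_le_card h).trans (Finset.card_image_le.trans hF)
    rw [Finset.card_range] at this
    omega
  rw [Finset.mem_range] at hj
  refine ⟨a + j * q, by omega, ?_, fun m hm hm' hmF => hjF (Finset.mem_image.2 ⟨m, hmF, ?_⟩)⟩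
  · have := Nat.mul_le_mul_right q hj
    rw [Nat.succ_mul] at this
    omega
  · refine Nat.div_eq_of_lt_le (by omega) ?_
    rw [Nat.add_mul]
    omega

theorem preconnected_induce_image_Ico {p : ℕ → V} {a b : ℕ}
    (hp : ∀ m, a ≤ m → m + 1 < b → G.Adj (p m) (p (m + 1))) :
    (G.induce (p '' Set.Ico a b)).Preconnected := by
  have key : ∀ d (h : a + d < b), (G.induce (p '' Set.Ico a b)).Reachable
      ⟨p a, a, ⟨le_rfl, by omega⟩, rfl⟩ ⟨p (a + d), a + d, ⟨by omega, h⟩, rfl⟩ := by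
    intro d
    induction d with
    | zero => intro _; exact Reachable.rfl
    | succ d ih =>
      intro h
      refine (ih (by omega)).trans (Adj.reachable ?_)
      exact hp (a + d) (by omega) (by omega)
  have key' : ∀ x : p '' Set.Ico a b, ∃ h : a < b, (G.induce (p '' Set.Ico a b)).Reachable
      ⟨p a, a, ⟨le_rfl, h⟩, rfl⟩ x := by
    rintro ⟨_, m, ⟨hm, hm'⟩, rfl⟩
    obtain ⟨d, rfl⟩ := Nat.exists_eq_add_of_le hm
    exact ⟨by omega, key d hm'⟩
  intro x y
  obtain ⟨_, hx⟩ := key' x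
  obtain ⟨_, hy⟩ := key' y
  exact hx.symm.trans hy

/-- Disjoint small connected sets `B 0, …, B i`, consecutive ones being joined by an edge and each
being joined to few of the previous ones, together with an interval of the path `p` which is
joined to `B i` and all of whose vertices are joined to at most `t` of the sets before `B i`. -/
structure IsBlockSequence (G : SimpleGraph V) (p : ℕ → V) (k t i a q : ℕ) (B : ℕ → Finset V) :
    Prop where
  card_le : ∀ j ≤ i, (B j).card ≤ k
  preconnected : ∀ j ≤ i, (G.induce (B j : Set V)).Preconnected
  nonempty : ∀ j ≤ i, (B j).Nonempty
  disjoint : ∀ l j, l < j → j ≤ i → ∀ x ∈ B j, x ∉ B l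
  adj : ∀ j < i, ∃ x ∈ B j, ∃ y ∈ B (j + 1), G.Adj x y
  few : ∀ j ≤ i, {l | l < j ∧ ∃ x ∈ B j, ∃ y ∈ B l, G.Adj x y}.ncard ≤ k * (t + 1)
  avoid : ∀ j ≤ i, ∀ m, a ≤ m → m < a + q → p m ∉ B j
  sparse : ∀ m, a ≤ m → m < a + q → {l | l < i ∧ ∃ y ∈ B l, G.Adj (p m) y}.ncard ≤ t
  link : ∃ x ∈ B i, ∃ m, a ≤ m ∧ m < a + q ∧ G.Adj x (p m)

/-- The blocks are disjoint, so choosing one neighbour in each touched block is injective. This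
turns a bound on neighbours into the bound on blocks required by `sparse`. -/
theorem IsBlockSequence.ncard_indices_le {p : ℕ → V} {k t i a q : ℕ} {B : ℕ → Finset V}
    (h : IsBlockSequence G p k t i a q B) (v : V) :
    {l | l < i + 1 ∧ ∃ y ∈ B l, G.Adj v y}.ncard ≤
      {x | (∃ l ≤ i, x ∈ B l) ∧ G.Adj v x}.ncard := by
  classical
  have hfin : {x | (∃ l ≤ i, x ∈ B l) ∧ G.Adj v x}.Finite := by
    refine ((Finset.range (i + 1)).biUnion B).finite_toSet.subset ?_
    rintro x ⟨⟨l, hl, hx⟩, -⟩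
    simp only [Finset.coe_biUnion, Finset.coe_range, Set.mem_Iio, Set.mem_iUnion, Finset.mem_coe]
    exact ⟨l, by omega, hx⟩
  have hch : ∀ l, ∃ y, l ∈ {l | l < i + 1 ∧ ∃ y ∈ B l, G.Adj v y} → y ∈ B l ∧ G.Adj v y := by
    intro l
    by_cases hl : l ∈ {l | l < i + 1 ∧ ∃ y ∈ B l, G.Adj v y}
    · obtain ⟨-, y, hy⟩ := hl
      exact ⟨y, fun _ => hy⟩
    · exact ⟨v, fun h => absurd h hl⟩
  choose g hg using hch
  refine Set.ncard_le_ncard_of_injOn g (fun l hl => ⟨⟨l, ?_, (hg l hl).1⟩, (hg l hl).2⟩) ?_ hfin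
  · have := hl.1
    omega
  · intro l hl l' hl' hll'
    have h1 := hl.1
    have h2 := hl'.1
    rcases lt_trichotomy l l' with hlt | hlt | hlt
    · exact absurd (hll' ▸ (hg l hl).1) (h.disjoint l l' hlt (by omega) _ (hg l' hl').1)
    · exact hlt
    · exact absurd (hll' ▸ (hg l' hl').1) (h.disjoint l' l hlt (by omega) _ (hg l hl).1)

/-- The new block lies in the old interval, so the old `sparse` bounds its backward contacts and the
old `avoid` makes it disjoint from earlier blocks. The new interval is chosen so that `sparse` holds
again with `B i` counted. -/
theorem IsBlockSequence.exists_succ [Finite V] {p : ℕ → V} {n k t i a q s : ℕ} {B : ℕ → Finset V}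
    (hk : ∀ m, k ≤ m → ¬ (pathGraph m).IsIndContained G)
    (hG : ∀ A : Finset V, A.card = t → {v | ∀ a ∈ A, G.Adj v a}.ncard < t)
    (hinj : Set.InjOn p (Set.Iio n)) (hp : ∀ m, m + 1 < n → G.Adj (p m) (p (m + 1)))
    (hs : (k * (i + 1)) ^ t * t + 1 ≤ s) (hq : 1 ≤ q) (hn : a + (s + 1) * q ≤ n)
    (h : IsBlockSequence G p k t i a ((s + 1) * q) B) :
    ∃ B' b, b + q ≤ n ∧ IsBlockSequence G p k t (i + 1) b q B' := by
  classical
  obtain ⟨x₀, hx₀, m₀, hm₀, hm₀', hadj₀⟩ := h.link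
  set X : Finset V := (Finset.range (i + 1)).biUnion B with hX
  have hmemX : ∀ x, x ∈ X ↔ ∃ l ≤ i, x ∈ B l := by
    intro x
    simp only [hX, Finset.mem_biUnion, Finset.mem_range, Nat.lt_succ_iff]
  have hXcard : X.card ≤ k * (i + 1) := by
    have := Finset.card_biUnion_le_card_mul (Finset.range (i + 1)) B k
      fun j hj => h.card_le j (by rw [Finset.mem_range] at hj; omega)
    rwa [Finset.card_range, mul_comm] at this
  set W : Set V := {v | t ≤ {x | x ∈ X ∧ G.Adj v x}.ncard} with hW
  have hWcard : W.ncard ≤ (k * (i + 1)) ^ t * t :=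
    (ncard_many_neighbors_le hG X).trans
      (Nat.mul_le_mul_right _ (Nat.pow_le_pow_left hXcard t))
  let F₁ : Finset ℕ := (Finset.Ico a (a + (s + 1) * q)).filter fun m => p m ∈ W
  have hF₁ : F₁.card ≤ W.ncard := by
    rw [← Set.ncard_coe_finset]
    refine Set.ncard_le_ncard_of_injOn p (fun m hm => ?_) (fun m hm m' hm' hmm' => ?_)
      (Set.toFinite W)
    · simp only [F₁, Finset.coe_filter] at hm
      exact hm.2
    · simp only [F₁, Finset.coe_filter, Finset.mem_Ico] at hm hm'
      exact hinj (show m < n by have := hm.1.2; omega) (show m' < n by have := hm'.1.2; omega) hmm'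
  -- The index `m₀` is also forbidden, so that the connection starts outside its target; this is the
  -- `+ 1` in `hs`.
  obtain ⟨b, hab, hb, hbF⟩ := exists_subinterval_avoiding (insert m₀ F₁) (s := s)
    ((Finset.card_insert_le _ _).trans (by omega)) a q
  have hbW : ∀ m, b ≤ m → m < b + q → p m ∉ W := by
    intro m hm hm' hmW
    refine hbF m hm hm' (Finset.mem_insert_of_mem ?_)
    simp only [F₁, Finset.mem_filter, Finset.mem_Ico]
    exact ⟨⟨by omega, by omega⟩, hmW⟩
  have hJ₀ : p m₀ ∉ p '' Set.Ico b (b + q) := by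
    rintro ⟨m, ⟨hm, hm'⟩, hmm⟩
    have : m = m₀ := hinj (show m < n by omega) (show m₀ < n by omega) hmm
    exact hbF m hm hm' (this ▸ Finset.mem_insert_self _ _)
  obtain ⟨R, hRU, haR, hRk, hRconn, x₁, hx₁, y₁, hy₁, hadj₁⟩ := exists_small_connector hk
    (U := p '' Set.Ico a (a + (s + 1) * q)) (J := p '' Set.Ico b (b + q)) (a := p m₀)
    (preconnected_induce_image_Ico fun m _ hm => hp m (by omega)) ⟨m₀, ⟨hm₀, hm₀'⟩, rfl⟩
    (Set.image_mono (Set.Ico_subset_Ico hab hb)) ⟨p b, b, ⟨le_rfl, by omega⟩, rfl⟩ hJ₀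
  have hRdisj : ∀ l ≤ i, ∀ x ∈ R, x ∉ B l := by
    intro l hl x hx
    obtain ⟨m, ⟨hm, hm'⟩, rfl⟩ := (hRU hx).1
    exact h.avoid l hl m hm hm'
  have hRfew : {l | l < i + 1 ∧ ∃ x ∈ R, ∃ y ∈ B l, G.Adj x y}.ncard ≤ k * (t + 1) := by
    have hfin : ∀ x, {l | l < i ∧ ∃ y ∈ B l, G.Adj x y}.Finite := fun x =>
      (Set.finite_Iio i).subset fun l hl => hl.1
    -- The index `i` is inserted because `sparse` only counts blocks before `B i`; hence `t + 1` per
    -- vertex.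
    have hsub : {l | l < i + 1 ∧ ∃ x ∈ R, ∃ y ∈ B l, G.Adj x y} ⊆
        ((R.biUnion fun x => insert i (hfin x).toFinset : Finset ℕ) : Set ℕ) := by
      rintro l ⟨hl, x, hx, y, hy, hxy⟩
      rw [Finset.mem_coe, Finset.mem_biUnion]
      refine ⟨x, hx, ?_⟩
      rw [Finset.mem_insert, Set.Finite.mem_toFinset]
      rcases Nat.lt_succ_iff_lt_or_eq.1 hl with hl | hl
      · exact Or.inr ⟨hl, y, hy, hxy⟩
      · exact Or.inl hl
    refine (Set.ncard_le_ncard hsub (Finset.finite_toSet _)).trans ?_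
    rw [Set.ncard_coe_finset]
    refine (Finset.card_biUnion_le_card_mul _ _ (t + 1) fun x hx => ?_).trans
      (Nat.mul_le_mul_right _ hRk)
    refine (Finset.card_insert_le _ _).trans (Nat.succ_le_succ ?_)
    rw [← Set.ncard_eq_toFinset_card _ (hfin x)]
    obtain ⟨m, ⟨hm, hm'⟩, rfl⟩ := (hRU hx).1
    exact h.sparse m hm hm'
  set B' : ℕ → Finset V := fun j => if j ≤ i then B j else R with hB'
  have hB : ∀ j ≤ i, B' j = B j := fun j hj => if_pos hj
  have hR : B' (i + 1) = R := if_neg (by omega)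
  refine ⟨B', b, by omega, ?_⟩
  have hsplit : ∀ {P : ℕ → Prop}, (∀ j ≤ i, P j) → P (i + 1) → ∀ j ≤ i + 1, P j := by
    intro P h1 h2 j hj
    rcases Nat.le_succ_iff.1 hj with hj | rfl
    · exact h1 j hj
    · exact h2
  constructor
  · refine hsplit (fun j hj => ?_) ?_
    · rw [hB j hj]; exact h.card_le j hj
    · rw [hR]; exact hRk
  · refine hsplit (fun j hj => ?_) ?_
    · rw [hB j hj]; exact h.preconnected j hj
    · rw [hR]; exact hRconn
  · refine hsplit (fun j hj => ?_) ?_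
    · rw [hB j hj]; exact h.nonempty j hj
    · rw [hR]; exact ⟨_, haR⟩
  · intro l j hlj hj
    rw [hB l (by omega)]
    revert hlj
    revert j
    refine hsplit (fun j hj hlj => ?_) (fun hl => ?_)
    · rw [hB j hj]; exact h.disjoint l j hlj hj
    · rw [hR]; exact hRdisj l (by omega)
  · intro j hj
    rw [hB j (by omega)]
    rcases Nat.lt_succ_iff_lt_or_eq.1 hj with hj | rfl
    · rw [hB (j + 1) (by omega)]; exact h.adj j hj
    · rw [hR]; exact ⟨x₀, hx₀, p m₀, haR, hadj₀⟩
  · intro j hj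
    have hset : {l | l < j ∧ ∃ x ∈ B' j, ∃ y ∈ B' l, G.Adj x y} =
        {l | l < j ∧ ∃ x ∈ B' j, ∃ y ∈ B l, G.Adj x y} := by
      ext l
      refine and_congr_right fun hl => ?_
      rw [hB l (by omega)]
    rw [hset]
    rcases Nat.le_succ_iff.1 hj with hj | rfl
    · rw [hB j hj]; exact h.few j hj
    · rw [hR]; exact hRfew
  · refine hsplit (fun j hj m hm hm' => ?_) (fun m hm hm' => ?_)
    · rw [hB j hj]; exact h.avoid j hj m (by omega) (by omega)
    · rw [hR]; exact fun hmR => (hRU hmR).2 ⟨m, ⟨hm, hm'⟩, rfl⟩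
  · intro m hm hm'
    have hset : {l | l < i + 1 ∧ ∃ y ∈ B' l, G.Adj (p m) y} =
        {l | l < i + 1 ∧ ∃ y ∈ B l, G.Adj (p m) y} := by
      ext l
      refine and_congr_right fun hl => ?_
      rw [hB l (by omega)]
    rw [hset]
    refine (h.ncard_indices_le (p m)).trans ?_
    have := hbW m hm hm'
    simp only [hW, Set.mem_ofPred_eq, not_le, hmemX] at this
    exact this.le
  · obtain ⟨m, ⟨hm, hm'⟩, rfl⟩ := hy₁
    exact ⟨x₁, hR.symm ▸ hx₁, m, hm, hm', hadj₁⟩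

/-- A graph in which every `t` vertices have fewer than `t` common neighbours and which has a very
long path has a long induced path. -/
theorem exists_induced_path_of_long_path [Finite V] {p : ℕ → V} {n k t L M : ℕ} (hk : 1 ≤ k)
    (hG : ∀ A : Finset V, A.card = t → {v | ∀ a ∈ A, G.Adj v a}.ncard < t)
    (hinj : Set.InjOn p (Set.Iio n)) (hp : ∀ m, m + 1 < n → G.Adj (p m) (p (m + 1)))
    (hL : (k * (t + 1) + 1) ^ k ≤ L) (hM : (k * L) ^ t * t + 2 ≤ M) (hn : M ^ L + 1 ≤ n) :
    ∃ m, k ≤ m ∧ (pathGraph m).IsIndContained G := by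
  by_contra! hno
  have hM1 : ∀ r, 1 ≤ M ^ r := fun r => Nat.one_le_pow _ _ (by omega)
  have hbuild : ∀ i ≤ L, ∃ B a, a + M ^ (L - i) ≤ n ∧
      IsBlockSequence G p k t i a (M ^ (L - i)) B := by
    intro i
    induction i with
    | zero =>
      intro _
      have hpos := hM1 L
      -- The vertex `p 0` is the first block and the interval starts at 1, which accounts for the `+
      -- 1` in `hn`.
      refine ⟨fun _ => {p 0}, 1, by rw [Nat.sub_zero]; omega, ?_⟩
      rw [Nat.sub_zero]
      constructor
      · intro j _; simpa using hk
      · intro j _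
        rw [Finset.coe_singleton]
        have : Subsingleton (({p 0} : Set V) : Type _) := inferInstance
        exact Preconnected.of_subsingleton
      · simp
      · omega
      · omega
      · intro j hj
        obtain rfl : j = 0 := by omega
        simp
      · intro j _ m hm hm' hmem
        rw [Finset.mem_singleton] at hmem
        have := hinj (show m < n by omega) (show 0 < n by omega) hmem
        omega
      · intro m _ _
        simp
      · exact ⟨p 0, by simp, 1, le_rfl, by omega, hp 0 (by omega)⟩
    | succ i ih =>
      intro hi
      obtain ⟨B, a, ha, h⟩ := ih (by omega)
      -- Each step shrinks the interval by the factor `M`; `M - 1` takes the role of `s` in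
      -- `exists_succ`.
      have hpow : M ^ (L - i) = (M - 1 + 1) * M ^ (L - (i + 1)) := by
        rw [show L - i = L - (i + 1) + 1 by omega, pow_succ, mul_comm]
        congr 1
        omega
      rw [hpow] at ha h
      have hs : (k * (i + 1)) ^ t * t ≤ (k * L) ^ t * t := by gcongr
      exact h.exists_succ hno hG hinj hp (by omega) (hM1 _) ha
  obtain ⟨B, a, -, h⟩ := hbuild L le_rfl
  obtain ⟨m, hm, hm'⟩ := exists_induced_path_of_blocks (G := G) (fun j => (B j : Set V)) L
    (k * (t + 1)) k h.preconnected h.nonempty h.disjoint h.adj h.few hL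
  exact hno m hm.le hm'

end SimpleGraph

/-! ### Ramsey's theorem, cliques and complete bipartite graphs -/

/-- Ramsey's theorem for graphs, on a subset of the vertices. -/
theorem exists_clique_or_independent (a b : ℕ) : ∃ N : ℕ, ∀ (V : Type) (G : SimpleGraph V)
    (S : Finset V), N ≤ S.card →
      (∃ A ⊆ S, A.card = a ∧ ∀ x ∈ A, ∀ y ∈ A, x ≠ y → G.Adj x y) ∨
      ∃ A ⊆ S, A.card = b ∧ ∀ x ∈ A, ∀ y ∈ A, ¬ G.Adj x y := by
  classical
  induction a generalizing b with
  | zero => exact ⟨0, fun V G S _ => Or.inl ⟨∅, by simp⟩⟩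
  | succ a iha =>
    induction b with
    | zero => exact ⟨0, fun V G S _ => Or.inr ⟨∅, by simp⟩⟩
    | succ b ihb =>
      obtain ⟨N₁, h₁⟩ := iha (b + 1)
      obtain ⟨N₂, h₂⟩ := ihb
      refine ⟨N₁ + N₂ + 1, fun V G S hS => ?_⟩
      obtain ⟨v, hv⟩ : S.Nonempty := Finset.card_pos.1 (by omega)
      have hcard := Finset.card_filter_add_card_filter_not (s := S.erase v) (G.Adj v)
      rw [Finset.card_erase_of_mem hv] at hcard
      have hsub : ∀ (P : V → Prop) [DecidablePred P], (S.erase v).filter P ⊆ S := fun P _ =>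
        (Finset.filter_subset _ _).trans (Finset.erase_subset _ _)
      by_cases hN : N₁ ≤ ((S.erase v).filter (G.Adj v)).card
      · rcases h₁ V G _ hN with ⟨A, hA, hAa, hadj⟩ | ⟨A, hA, h⟩
        · have hvA : ∀ x ∈ A, G.Adj v x := fun x hx => (Finset.mem_filter.1 (hA hx)).2
          have hv' : v ∉ A := fun h => G.loopless.irrefl _ (hvA v h)
          refine Or.inl ⟨insert v A, Finset.insert_subset hv (hA.trans (hsub _)),
            by rw [Finset.card_insert_of_notMem hv', hAa], ?_⟩
          intro x hx y hy hxy
          rcases Finset.mem_insert.1 hx with rfl | hxA <;>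
            rcases Finset.mem_insert.1 hy with rfl | hyA
          · exact absurd rfl hxy
          · exact hvA y hyA
          · exact (hvA x hxA).symm
          · exact hadj x hxA y hyA hxy
        · exact Or.inr ⟨A, hA.trans (hsub _), h⟩
      · rcases h₂ V G ((S.erase v).filter fun x => ¬ G.Adj v x) (by omega) with
          ⟨A, hA, h⟩ | ⟨A, hA, hAb, hadj⟩
        · exact Or.inl ⟨A, hA.trans (hsub _), h⟩
        · have hvA : ∀ x ∈ A, ¬ G.Adj v x := fun x hx => (Finset.mem_filter.1 (hA hx)).2
          have hv' : v ∉ A := fun h =>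
            Finset.notMem_erase v S (Finset.mem_filter.1 (hA h)).1
          refine Or.inr ⟨insert v A, Finset.insert_subset hv (hA.trans (hsub _)),
            by rw [Finset.card_insert_of_notMem hv', hAb], ?_⟩
          intro x hx y hy
          rcases Finset.mem_insert.1 hx with rfl | hxA <;>
            rcases Finset.mem_insert.1 hy with rfl | hyA
          · exact G.loopless.irrefl _
          · exact hvA y hyA
          · exact fun h => hvA x hxA h.symm
          · exact hadj x hxA y hyA

theorem top_isIndContained_of_clique {V : Type} {G : SimpleGraph V} {A : Finset V} {s : ℕ}
    (hA : A.card = s) (hadj : ∀ x ∈ A, ∀ y ∈ A, x ≠ y → G.Adj x y) :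
    (⊤ : SimpleGraph (Fin s)).IsIndContained G := by
  let e := (A.equivFinOfCardEq hA).symm
  refine ⟨⟨⟨fun i => (e i : V), fun i j h => e.injective (Subtype.ext h)⟩, ?_⟩⟩
  intro i j
  rw [SimpleGraph.top_adj]
  refine ⟨fun h hij => G.loopless.irrefl _ (hij ▸ h), fun h => ?_⟩
  exact hadj _ (e i).2 _ (e j).2 fun h' => h (e.injective (Subtype.ext h'))

theorem completeBipartite_isIndContained {V : Type} {G : SimpleGraph V} {A B : Finset V} {s : ℕ}
    (hA : A.card = s) (hB : B.card = s) (hA' : ∀ x ∈ A, ∀ y ∈ A, ¬ G.Adj x y)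
    (hB' : ∀ x ∈ B, ∀ y ∈ B, ¬ G.Adj x y) (hAB : ∀ x ∈ A, ∀ y ∈ B, G.Adj x y) :
    (completeBipartiteGraph (Fin s) (Fin s)).IsIndContained G := by
  let e := (A.equivFinOfCardEq hA).symm
  let f := (B.equivFinOfCardEq hB).symm
  have hef : ∀ i j, (e i : V) ≠ f j := fun i j h =>
    G.loopless.irrefl _ (h ▸ hAB _ (e i).2 _ (f j).2)
  refine ⟨⟨⟨Sum.elim (fun i => (e i : V)) (fun i => (f i : V)), ?_⟩, ?_⟩⟩
  · rintro (i | i) (j | j) h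
    · exact congrArg _ (e.injective (Subtype.ext h))
    · exact absurd h (hef i j)
    · exact absurd h.symm (hef j i)
    · exact congrArg _ (f.injective (Subtype.ext h))
  · rintro (i | i) (j | j)
    · exact iff_of_false (hA' _ (e i).2 _ (e j).2) (by simp)
    · exact iff_of_true (hAB _ (e i).2 _ (f j).2) (by simp)
    · exact iff_of_true (hAB _ (e j).2 _ (f i).2).symm (by simp)
    · exact iff_of_false (hB' _ (f i).2 _ (f j).2) (by simp)

theorem hasPathOfOrder_completeBipartite (n : ℕ) :
    HasPathOfOrder (completeBipartiteGraph (Fin n) (Fin n)) n := by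
  refine ⟨⟨⟨fun i => if (i : ℕ) % 2 = 0 then Sum.inl i else Sum.inr i, ?_⟩, ?_⟩⟩
  · intro i j h
    rw [SimpleGraph.pathGraph_adj] at h
    by_cases hi : (i : ℕ) % 2 = 0
    · have hj : ¬ (j : ℕ) % 2 = 0 := by omega
      simp [hi, hj]
    · have hj : (j : ℕ) % 2 = 0 := by omega
      simp [hi, hj]
  · intro i j h
    simp only [RelHom.coeFn_mk] at h
    split_ifs at h <;> simpa using h

theorem le_two_of_hasInducedPath_top {W : Type} {m : ℕ}
    (h : HasInducedPathOfOrder (⊤ : SimpleGraph W) m) : m ≤ 2 := by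
  obtain ⟨f⟩ := h
  by_contra! hm
  have h1 : ¬ (SimpleGraph.pathGraph m).Adj ⟨0, by omega⟩ ⟨2, hm⟩ := by
    simp [SimpleGraph.pathGraph_adj]
  rw [← f.map_adj_iff, SimpleGraph.top_adj, not_not] at h1
  simpa using f.injective h1

theorem le_three_of_hasInducedPath_completeBipartite {U W : Type} {m : ℕ}
    (h : HasInducedPathOfOrder (completeBipartiteGraph U W) m) : m ≤ 3 := by
  obtain ⟨f⟩ := h
  by_contra! hm
  have h1 : (SimpleGraph.pathGraph m).Adj ⟨0, by omega⟩ ⟨1, by omega⟩ := by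
    simp [SimpleGraph.pathGraph_adj]
  have h2 : (SimpleGraph.pathGraph m).Adj ⟨1, by omega⟩ ⟨2, by omega⟩ := by
    simp [SimpleGraph.pathGraph_adj]
  have h3 : (SimpleGraph.pathGraph m).Adj ⟨2, by omega⟩ ⟨3, by omega⟩ := by
    simp [SimpleGraph.pathGraph_adj]
  have h4 : ¬ (SimpleGraph.pathGraph m).Adj ⟨0, by omega⟩ ⟨3, by omega⟩ := by
    simp [SimpleGraph.pathGraph_adj]
  rw [← f.map_adj_iff] at h1 h2 h3 h4
  simp only [completeBipartiteGraph_adj] at h1 h2 h3 h4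
  -- Every edge changes sides, so the first and fourth vertices lie on opposite sides and would be
  -- adjacent.
  grind

theorem exists_path_function {V : Type} {G : SimpleGraph V} {n : ℕ} (hn : 1 ≤ n)
    (h : HasPathOfOrder G n) : ∃ p : ℕ → V, Set.InjOn p (Set.Iio n) ∧
      ∀ m, m + 1 < n → G.Adj (p m) (p (m + 1)) := by
  obtain ⟨f⟩ := h
  refine ⟨fun m => if hm : m < n then f ⟨m, hm⟩ else f ⟨0, hn⟩, ?_, ?_⟩
  · intro i hi j hj hij
    rw [Set.mem_Iio] at hi hj
    simp only [dif_pos hi, dif_pos hj] at hij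
    simpa using f.injective hij
  · intro m hm
    simp only [dif_pos hm, dif_pos (show m < n by omega)]
    exact f.toHom.map_adj (by simp [SimpleGraph.pathGraph_adj])

/-! ### Choice of parameters, and the two growth regimes -/

theorem exists_parameters (t : ℕ) : ∃ C : ℕ, 1 ≤ C ∧ ∀ k n : ℕ, 1 ≤ k →
    2 ^ 2 ^ (C * k ^ 2) ≤ n → ∃ L M : ℕ, (k * (t + 1) + 1) ^ k ≤ L ∧
      (k * L) ^ t * t + 2 ≤ M ∧ M ^ L + 1 ≤ n := by
  -- The three summands bound, as multiples of `k ^ 2`, the terms `(k + u) * t`, `t + 2` and `u` of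
  -- `e + u`, where L = 2^u and M = 2^e.
  refine ⟨(2 + t) * t + (t + 2) + (1 + t), by omega, fun k n hk hn => ?_⟩
  set u := (k + t) * k with hu
  set e := (k + u) * t + t + 2 with he
  have hk2 : k < 2 ^ k := Nat.lt_two_pow_self
  have ht2 : t < 2 ^ t := Nat.lt_two_pow_self
  have he2 : e < 2 ^ e := Nat.lt_two_pow_self
  have hpow : ∀ r, 1 ≤ 2 ^ r := fun r => Nat.one_le_two_pow
  refine ⟨2 ^ u, 2 ^ e, ?_, ?_, ?_⟩
  · rw [hu, pow_mul]
    refine Nat.pow_le_pow_left ?_ k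
    calc k * (t + 1) + 1 ≤ (k + 1) * (t + 1) := by nlinarith
      _ ≤ 2 ^ k * 2 ^ t := Nat.mul_le_mul hk2 ht2
      _ = 2 ^ (k + t) := (pow_add _ _ _).symm
  · calc (k * 2 ^ u) ^ t * t + 2 ≤ (2 ^ k * 2 ^ u) ^ t * 2 ^ t + 2 := by gcongr
      _ = 2 ^ ((k + u) * t + t) + 2 := by rw [← pow_add, ← pow_mul, ← pow_add]
      _ ≤ 2 ^ ((k + u) * t + t) * 4 := by have := hpow ((k + u) * t + t); omega
      _ = 2 ^ e := by rw [he, pow_add _ _ 2]; norm_num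
  · have h1 : e * 2 ^ u + 1 ≤ 2 ^ (e + u) := by
      rw [pow_add]
      have := hpow u
      nlinarith
    have h2 : e + u ≤ ((2 + t) * t + (t + 2) + (1 + t)) * k ^ 2 := by
      have hk' : 1 ≤ k ^ 2 := Nat.one_le_pow _ _ hk
      have hkk : k ≤ k ^ 2 := by nlinarith
      have hu' : u ≤ (1 + t) * k ^ 2 := by rw [hu]; nlinarith
      have h3 : (k + u) * t ≤ ((2 + t) * k ^ 2) * t := Nat.mul_le_mul_right _ (by nlinarith)
      have h4 : t + 2 ≤ (t + 2) * k ^ 2 := Nat.le_mul_of_pos_right _ hk'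
      calc e + u ≤ ((2 + t) * k ^ 2) * t + (t + 2) * k ^ 2 + (1 + t) * k ^ 2 := by omega
        _ = _ := by ring
    calc (2 ^ e) ^ 2 ^ u + 1 = 2 ^ (e * 2 ^ u) + 1 := by rw [← pow_mul]
      _ ≤ 2 ^ (e * 2 ^ u + 1) := by rw [pow_succ]; have := hpow (e * 2 ^ u); omega
      _ ≤ 2 ^ 2 ^ (e + u) := Nat.pow_le_pow_right (by norm_num) h1
      _ ≤ 2 ^ 2 ^ _ := Nat.pow_le_pow_right (by norm_num) (Nat.pow_le_pow_right (by norm_num) h2)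
      _ ≤ n := hn

namespace GraphClass

theorem forcesInducedPath_of_no_biclique {C : GraphClass} {t : ℕ}
    (hC : ∀ (V : Type) [Finite V] (G : SimpleGraph V), C V G →
      ∀ A : Finset V, A.card = t → {v | ∀ a ∈ A, G.Adj v a}.ncard < t) :
    ∃ D : ℕ, 1 ≤ D ∧ ∀ k n : ℕ, 1 ≤ k → 2 ^ 2 ^ (D * k ^ 2) ≤ n → C.ForcesInducedPath n k := by
  obtain ⟨D, hD, h⟩ := exists_parameters t
  refine ⟨D, hD, fun k n hk hn V _ G hG hP => ?_⟩
  obtain ⟨L, M, hL, hM, hn'⟩ := h k n hk hn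
  obtain ⟨p, hinj, hp⟩ := exists_path_function (by omega) hP
  exact SimpleGraph.exists_induced_path_of_long_path hk (hC V G hG) hinj hp hL hM hn'

theorem isBigOmega_of_forcesInducedPath {C : GraphClass} {D : ℕ} (hD : 1 ≤ D)
    (h : ∀ k n : ℕ, 1 ≤ k → 2 ^ 2 ^ (D * k ^ 2) ≤ n → C.ForcesInducedPath n k) :
    IsBigOmega C.inducedPathFn fun n : ℕ => (Real.logb 2 (Real.logb 2 (n : ℝ))) ^ (1 / 2 : ℝ) := by
  have hD0 : (0 : ℝ) < D := by exact_mod_cast hD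
  -- The best `k` is the integer part of y = √(x/D), where D y² = x = log log n. Since ⌊y⌋ ≥ y/2 for
  -- y ≥ 1, rounding costs the factor 2; the threshold 2^(2^D) below ensures y ≥ 1.
  refine ⟨1 / (2 * √D), by positivity, ?_⟩
  filter_upwards [eventually_ge_atTop (2 ^ 2 ^ D)] with n hn
  set x := Real.logb 2 (Real.logb 2 (n : ℝ)) with hx
  have hn0 : (0 : ℝ) < n := by
    have : 0 < n := lt_of_lt_of_le (by positivity) hn
    exact_mod_cast this
  have hlog : ∀ r : ℕ, (2 : ℝ) ^ 2 ^ r ≤ n ↔ (r : ℝ) ≤ x := by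
    intro r
    have hn1 : 1 < n := lt_of_lt_of_le (Nat.one_lt_two_pow (by positivity)) hn
    have hpos : 0 < Real.logb 2 (n : ℝ) := Real.logb_pos (by norm_num) (by exact_mod_cast hn1)
    rw [hx, Real.le_logb_iff_rpow_le (by norm_num) hpos, Real.rpow_natCast,
      Real.le_logb_iff_rpow_le (by norm_num) hn0]
    have : ((2 : ℝ) ^ r) = ((2 ^ r : ℕ) : ℝ) := by push_cast; rfl
    rw [this, Real.rpow_natCast]
  have hxD : (D : ℝ) ≤ x := (hlog D).1 (by exact_mod_cast hn)
  have hx0 : 0 ≤ x := hD0.le.trans hxD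
  set y := √(x / D) with hy
  have hy1 : 1 ≤ y := by
    rw [hy, Real.one_le_sqrt, le_div_iff₀ hD0]
    linarith
  have hk1 : 1 ≤ ⌊y⌋₊ := Nat.one_le_floor_iff y |>.2 hy1
  have hky : (⌊y⌋₊ : ℝ) ≤ y := Nat.floor_le (by linarith)
  have hkn : 2 ^ 2 ^ (D * ⌊y⌋₊ ^ 2) ≤ n := by
    have : ((D * ⌊y⌋₊ ^ 2 : ℕ) : ℝ) ≤ x := by
      push_cast
      calc (D : ℝ) * (⌊y⌋₊ : ℝ) ^ 2 ≤ D * y ^ 2 := by gcongr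
        _ = x := by
          rw [hy, Real.sq_sqrt (by positivity)]
          field_simp
    exact_mod_cast (hlog _).2 this
  have hle : ((⌊y⌋₊ : ℕ) : ℕ∞) ≤ C.inducedPathFn n :=
    le_iSup₂_of_le (f := fun (k : ℕ) (_ : C.ForcesInducedPath n k) => (k : ℕ∞)) ⌊y⌋₊
      (h _ n hk1 hkn) le_rfl
  have hreal : 1 / (2 * √D) * x ^ (1 / 2 : ℝ) ≤ (⌊y⌋₊ : ℝ) := by
    have h1 : 1 / (2 * √D) * x ^ (1 / 2 : ℝ) = y / 2 := by
      rw [← Real.sqrt_eq_rpow, hy, Real.sqrt_div hx0]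
      field_simp
    have h2 := Nat.lt_floor_add_one y
    have h3 : (1 : ℝ) ≤ (⌊y⌋₊ : ℝ) := by exact_mod_cast hk1
    rw [h1]
    linarith
  calc ENNReal.ofReal (1 / (2 * √D) * x ^ (1 / 2 : ℝ)) ≤ ENNReal.ofReal (⌊y⌋₊ : ℝ) :=
        ENNReal.ofReal_le_ofReal hreal
    _ = (((⌊y⌋₊ : ℕ) : ℕ∞) : ENNReal) := by simp
    _ ≤ _ := by exact_mod_cast hle

theorem isBigOOne_of_forall_mem {C : GraphClass} {K : ℕ}
    (h : ∀ n, ∃ (V : Type) (_ : Finite V) (G : SimpleGraph V), C V G ∧ HasPathOfOrder G n ∧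
      ∀ m, HasInducedPathOfOrder G m → m ≤ K) : IsBigOOne C.inducedPathFn := by
  refine ⟨K, fun n => iSup₂_le fun k hk => ?_⟩
  obtain ⟨V, _, G, hG, hP, hK⟩ := h n
  obtain ⟨m, hkm, hm⟩ := hk V G hG hP
  exact_mod_cast hkm.trans (hK m hm)

theorem isBigOOne_of_forall_biclique {C : GraphClass} (hC : C.IsHereditary)
    (h : ∀ t : ℕ, ∃ (V : Type) (_ : Finite V) (G : SimpleGraph V), C V G ∧
      ∃ A : Finset V, A.card = t ∧ t ≤ {v | ∀ a ∈ A, G.Adj v a}.ncard) :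
    IsBigOOne C.inducedPathFn := by
  classical
  by_cases hclique : ∀ s, C (Fin s) ⊤
  · refine isBigOOne_of_forall_mem (K := 2) fun n => ⟨Fin n, inferInstance, ⊤, hclique n, ?_,
      fun m => le_two_of_hasInducedPath_top⟩
    exact SimpleGraph.IsContained.of_le le_top
  · push Not at hclique
    obtain ⟨s, hs⟩ := hclique
    refine isBigOOne_of_forall_mem (K := 3) fun n => ⟨_, inferInstance,
      completeBipartiteGraph (Fin n) (Fin n), ?_, hasPathOfOrder_completeBipartite n,
      fun m => le_three_of_hasInducedPath_completeBipartite⟩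
    obtain ⟨N, hN⟩ := exists_clique_or_independent s n
    -- The biclique is taken with sides of Ramsey size `N`: with the clique of order `s` excluded,
    -- each side contains `n` independent vertices, and together these induce K_{n,n}.
    obtain ⟨V, _, G, hG, A, hA, hB⟩ := h N
    have hno : ∀ S : Finset V, N ≤ S.card →
        ∃ A ⊆ S, A.card = n ∧ ∀ x ∈ A, ∀ y ∈ A, ¬ G.Adj x y := by
      intro S hS
      refine (hN V G S hS).resolve_left ?_
      rintro ⟨A, -, hA, hadj⟩
      exact hs (hC _ _ G _ hG (top_isIndContained_of_clique hA hadj))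
    obtain ⟨A', hA', hAn, hAind⟩ := hno A hA.ge
    have hfin : {v | ∀ a ∈ A, G.Adj v a}.Finite := Set.toFinite _
    rw [Set.ncard_eq_toFinset_card _ hfin] at hB
    obtain ⟨B', hB', hBn, hBind⟩ := hno _ hB
    refine hC _ _ G _ hG (completeBipartite_isIndContained hAn hBn hAind hBind ?_)
    intro x hx y hy
    exact ((Set.Finite.mem_toFinset hfin).1 (hB' hy) x (hA' hx)).symm

end GraphClass

theorem corollary1p3 :
    ∃ c : ℝ, 0 < c ∧ ∀ C : GraphClass, C.IsHereditary →
      IsBigOmega C.inducedPathFn (fun n : ℕ => (Real.logb 2 (Real.logb 2 (n : ℝ))) ^ c) ∨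
        IsBigOOne C.inducedPathFn := by
  refine ⟨1 / 2, by norm_num, fun C hC => ?_⟩
  by_cases h : ∃ t : ℕ, ∀ (V : Type) [Finite V] (G : SimpleGraph V), C V G →
      ∀ A : Finset V, A.card = t → {v | ∀ a ∈ A, G.Adj v a}.ncard < t
  · obtain ⟨t, ht⟩ := h
    obtain ⟨D, hD, hforce⟩ := GraphClass.forcesInducedPath_of_no_biclique ht
    exact Or.inl (GraphClass.isBigOmega_of_forcesInducedPath hD hforce)
  · push Not at h
    refine Or.inr (GraphClass.isBigOOne_of_forall_biclique hC fun t => ?_)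
    obtain ⟨V, hV, G, hG, A, hA, hcard⟩ := h t
    exact ⟨V, hV, G, hG, A, hA, hcard⟩
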